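/- Let $C_d>1$. There is a constant $C=C(C_d)>0$, depending only on $C_d$, such that the following holds. Let $(X,d)$ be a complete metric space and $\mu$ a Borel measure on $X$ with $$0<\mu(B(x,2r))\le C_d\,\mu(B(x,r))<\infty\qquad\text{for all }x\in X,\ r>0,$$ where $B(x,r)$ denotes the open ball. Assume that $X$ satisfies an annular decay property: there are $0\le\alpha\le1$ and $K\ge1$ such that $\mu\big(B(x,r)\setminus B(x,(1-\delta)r)\big)\le K\delta^\alpha\mu(B(x,r))$ for all $x\in X$, $r>0$, $0<\delta<1$. For a real-valued $f\in L^1_{\mathrm{loc}}(X)$ let $f_B=\frac1{\mu(B)}\int_B f\,d\mu$ and $$\|f\|_{BMO}=\sup_{B}\frac1{\mu(B)}\int_B|f-f_B|\,d\mu,\qquad \|f\|_{BUO}=\sup_{B}\Big(\operatorname*{ess\,sup}_{B}f-f_B\Big),$$ the suprema being over all balls $B\subset X$; $BMO(X)$ and $BUO(X)$ consist of the $f\in L^1_{\mathrm{loc}}(X)$ (defined and finite almost everywhere) for which the respective quantity is finite. Define the natural minimal function and the minimal function of $f$ by $$m^\natural f(x)=\inf_{B\ni x}\frac1{\mu(B)}\int_B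 f\,d\mu\in[-\infty,\infty),\qquad mf(x)=\inf_{B\ni x}\frac1{\mu(B)}\int_B |f|\,d\mu,$$ the infima being over all balls containing $x$. Let $f\in BMO(X)$. Then 1. if $m^\natural f$ is not identically $-\infty$, then $m^\natural f\in BUO(X)$ and $\|m^\natural f\|_{BUO}\le C\|f\|_{BMO}$; 2. $mf\in BUO(X)$ and $\|mf\|_{BUO}\le C\|f\|_{BMO}$. -/

import Mathlib

open MeasureTheory Metric

universe u

noncomputable section

namespace MetricOscillation

variable {X : Type*} [MetricSpace X] [MeasurableSpace X]

/-- The doubling condition with constant `Cd`: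
`0 < μ(2B) ≤ Cd μ(B) < ∞` for every ball `B = B(x, r)`. -/
def IsDoubling (μ : Measure X) (Cd : ℝ) : Prop :=
  ∀ (x : X) (r : ℝ), 0 < r →
    0 < μ (ball x (2 * r)) ∧
    μ (ball x (2 * r)) ≤ ENNReal.ofReal Cd * μ (ball x r) ∧
    μ (ball x r) < ⊤

/-- The `α`-annular decay property. -/
def AnnularDecay (μ : Measure X) (α : ℝ) : Prop :=
  ∃ C : ℝ, 1 ≤ C ∧ ∀ (x : X) (r δ : ℝ), 0 < r → 0 < δ → δ < 1 →
    μ (ball x r \ ball x ((1 - δ) * r)) ≤ ENNReal.ofReal (C * δ ^ α) * μ (ball x r)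

/-- An annular decay property: `α`-annular decay for some `0 ≤ α ≤ 1`. -/
def HasAnnularDecay (μ : Measure X) : Prop :=
  ∃ α : ℝ, 0 ≤ α ∧ α ≤ 1 ∧ AnnularDecay μ α

/-- `‖f‖_BMO = sup_B ⨍_B |f - f_B|`. -/
def bmoNorm (μ : Measure X) (f : X → ℝ) : EReal :=
  ⨆ (c : X) (r : ℝ) (_ : 0 < r),
    ((⨍ y in ball c r, |f y - ⨍ z in ball c r, f z ∂μ| ∂μ : ℝ) : EReal)

/-- `f ∈ BMO`: `f` is locally integrable and `‖f‖_BMO < ∞`. -/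
def MemBMO (μ : Measure X) (f : X → ℝ) : Prop :=
  LocallyIntegrable f μ ∧ bmoNorm μ f < ⊤

/-- `‖g‖_BUO = sup_B (ess sup_B g - ⨍_B g)`, for an extended real valued `g`
which is finite almost everywhere. -/
def buoNorm (μ : Measure X) (g : X → EReal) : EReal :=
  ⨆ (c : X) (r : ℝ) (_ : 0 < r),
    (essSup g (μ.restrict (ball c r)) - ((⨍ y in ball c r, (g y).toReal ∂μ : ℝ) : EReal))

/-- `g ∈ BUO`: `g` is finite almost everywhere, locally integrable, and `‖g‖_BUO < ∞`. -/
def MemBUO (μ : Measure X) (g : X → EReal) : Prop :=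
  (∀ᵐ x ∂μ, g x ≠ ⊥ ∧ g x ≠ ⊤) ∧
  LocallyIntegrable (fun x => (g x).toReal) μ ∧
  buoNorm μ g < ⊤

/-- The natural minimal function `m^♮ f (x) = inf_{B ∋ x} ⨍_B f`, over all balls containing `x`. -/
def naturalMinimal (μ : Measure X) (f : X → ℝ) (x : X) : EReal :=
  ⨅ (c : X) (r : ℝ) (_ : 0 < r) (_ : x ∈ ball c r), ((⨍ y in ball c r, f y ∂μ : ℝ) : EReal)

/-- The minimal function `m f (x) = inf_{B ∋ x} ⨍_B |f|`, over all balls containing `x`. -/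
def minimal (μ : Measure X) (f : X → ℝ) (x : X) : EReal :=
  ⨅ (c : X) (r : ℝ) (_ : 0 < r) (_ : x ∈ ball c r), ((⨍ y in ball c r, |f y| ∂μ : ℝ) : EReal)

end MetricOscillation

end

/-!
For a ball `B`, the drop at `x ∈ B` is the largest amount by which the averages of `f` over small
balls containing `x` fall below its average over `2B`. Its average over `B` is at most `C ‖f‖_BMO`:
a Vitali subfamily of the balls with a large drop has small total measure, because `f` oscillates
on each of them, and after enlargement it covers all points with a large drop, where the drop
exceeds the drop relative to the enlarged selected ball by at most `C ‖f‖_BMO`. Truncating the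
radii from below, induction on the scale absorbs the latter contribution, with a constant
independent of the truncation.

Let `x, y ∈ B`. The average of `f` over a large ball containing `x` differs by at most `C ‖f‖_BMO`
from its average over a larger ball, which also contains `y`, and so is at least
`m♮ f y - C ‖f‖_BMO`; over a small ball containing `x`, it is at least `m♮ f y` minus the drop
at `x`. Hence `m♮ f y ≤ m♮ f x + C ‖f‖_BMO` plus the drop at `x`, and averaging over `x ∈ B` bounds
`m♮ f` on `B` by its mean. The second part is the first one applied to `|f|`.
-/

namespace MetricOscillation

open Filter Set
open scoped Topology ENNReal

section Average

variable {Y E : Type*} [MeasurableSpace Y] [NormedAddCommGroup E] [NormedSpace ℝ E]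
  {μ : Measure Y} {s t : Set Y} {f : Y → E}

theorem setAverage_sub_const [CompleteSpace E] (hs₀ : μ s ≠ 0) (hs : μ s ≠ ∞)
    (hf : IntegrableOn f s μ) (a : E) :
    ⨍ y in s, (f y - a) ∂μ = (⨍ y in s, f y ∂μ) - a := by
  have hc : IntegrableOn (fun _ => a) s μ := integrableOn_const hs
  calc ⨍ y in s, (f y - a) ∂μ = (⨍ y in s, f y ∂μ) - ⨍ _ in s, a ∂μ :=
        integral_sub hf.to_average hc.to_average
    _ = (⨍ y in s, f y ∂μ) - a := by rw [setAverage_const hs₀ hs]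

theorem norm_setAverage_sub_le [CompleteSpace E] (hs₀ : μ s ≠ 0) (hs : μ s ≠ ∞)
    (hf : IntegrableOn f s μ) (a : E) :
    ‖(⨍ y in s, f y ∂μ) - a‖ ≤ ⨍ y in s, ‖f y - a‖ ∂μ := by
  rw [← setAverage_sub_const hs₀ hs hf]
  exact norm_integral_le_integral_norm _

theorem enorm_setAverage_sub_le [CompleteSpace E] (hs₀ : μ s ≠ 0) (hs : μ s ≠ ∞)
    (hf : IntegrableOn f s μ) (a : E) :
    ‖(⨍ y in s, f y ∂μ) - a‖ₑ ≤ ⨍⁻ y in s, ‖f y - a‖ₑ ∂μ := by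
  rw [← setAverage_sub_const hs₀ hs hf]
  exact enorm_integral_le_lintegral_enorm _

theorem setAverage_norm_sub_setAverage_le [CompleteSpace E] (hs₀ : μ s ≠ 0) (hs : μ s ≠ ∞)
    (hf : IntegrableOn f s μ) (a : E) :
    ⨍ y in s, ‖f y - ⨍ z in s, f z ∂μ‖ ∂μ ≤ 2 * ⨍ y in s, ‖f y - a‖ ∂μ := by
  set m := ⨍ z in s, f z ∂μ
  have hsub : ∀ b : E, IntegrableOn (fun y => ‖f y - b‖) s μ := fun b =>
    (hf.sub (integrableOn_const hs)).norm
  have hc : IntegrableOn (fun _ => ‖m - a‖) s μ := integrableOn_const hs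
  calc ⨍ y in s, ‖f y - m‖ ∂μ
      ≤ ⨍ y in s, (‖f y - a‖ + ‖m - a‖) ∂μ :=
        integral_mono (hsub m).to_average ((hsub a).add hc).to_average fun y => by
          simpa only [norm_sub_rev m a] using norm_sub_le_norm_sub_add_norm_sub (f y) a m
    _ = (⨍ y in s, ‖f y - a‖ ∂μ) + ⨍ _ in s, ‖m - a‖ ∂μ :=
        integral_add (hsub a).to_average hc.to_average
    _ = (⨍ y in s, ‖f y - a‖ ∂μ) + ‖m - a‖ := by rw [setAverage_const hs₀ hs]
    _ ≤ 2 * ⨍ y in s, ‖f y - a‖ ∂μ := by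
        linarith [norm_setAverage_sub_le hs₀ hs hf a]

theorem setAverage_le_mul_setAverage_of_subset {g : Y → ℝ} {K : ℝ} (hg₀ : 0 ≤ g)
    (hg : IntegrableOn g t μ) (hst : s ⊆ t) (hs : 0 < μ.real s) (ht : μ t ≠ ∞)
    (hK : μ.real t ≤ K * μ.real s) :
    ⨍ y in s, g y ∂μ ≤ K * ⨍ y in t, g y ∂μ := by
  have ht₀ : 0 ≤ ⨍ y in t, g y ∂μ := integral_nonneg hg₀
  rw [setAverage_eq, smul_eq_mul, inv_mul_le_iff₀ hs]
  calc ∫ y in s, g y ∂μ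
      ≤ ∫ y in t, g y ∂μ :=
        setIntegral_mono_set hg (Eventually.of_forall hg₀) hst.eventuallyLE
    _ = μ.real t * ⨍ y in t, g y ∂μ := (measure_smul_setAverage g ht).symm
    _ ≤ K * μ.real s * ⨍ y in t, g y ∂μ := by gcongr
    _ = μ.real s * (K * ⨍ y in t, g y ∂μ) := by ring

end Average

section LIntegral

variable {Y ι : Type*} [MeasurableSpace Y] {μ : Measure Y} [Countable ι]

theorem mul_tsum_measure_le_lintegral {s : ι → Set Y} {t : Set Y} {g : Y → ℝ≥0∞} {l : ℝ≥0∞}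
    (hs : ∀ i, MeasurableSet (s i)) (hdisj : Pairwise (Function.onFun Disjoint s))
    (hst : ∀ i, s i ⊆ t) (hl : ∀ i, l * μ (s i) ≤ ∫⁻ y in s i, g y ∂μ) :
    l * ∑' i, μ (s i) ≤ ∫⁻ y in t, g y ∂μ :=
  calc l * ∑' i, μ (s i) = ∑' i, l * μ (s i) := ENNReal.tsum_mul_left.symm
    _ ≤ ∑' i, ∫⁻ y in s i, g y ∂μ := ENNReal.tsum_le_tsum hl
    _ = ∫⁻ y in ⋃ i, s i, g y ∂μ := (lintegral_iUnion hs hdisj g).symm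
    _ ≤ ∫⁻ y in t, g y ∂μ := lintegral_mono_set (iUnion_subset hst)

theorem setLIntegral_le_of_forall_le_or_exists_le {s : Set Y} {t : ι → Set Y} {h : Y → ℝ≥0∞}
    {g : ι → Y → ℝ≥0∞} {a : ℝ≥0∞} (hs : MeasurableSet s) (ht : ∀ i, MeasurableSet (t i))
    (hg : ∀ i, AEMeasurable (g i) (μ.restrict (t i)))
    (hle : ∀ y ∈ s, h y ≤ a ∨ ∃ i, y ∈ t i ∧ h y ≤ g i y) :
    ∫⁻ y in s, h y ∂μ ≤ a * μ s + ∑' i, ∫⁻ y in t i, g i y ∂μ := by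
  have hpointwise : ∀ y ∈ s, h y ≤ a + ∑' i, (t i).indicator (g i) y := by
    intro y hy
    obtain hya | ⟨i, hyi, hyg⟩ := hle y hy
    · exact le_add_right hya
    · refine le_add_left (hyg.trans ?_)
      rw [← indicator_of_mem hyi (g i)]
      exact ENNReal.le_tsum i
  calc ∫⁻ y in s, h y ∂μ
      ≤ ∫⁻ y in s, (a + ∑' i, (t i).indicator (g i) y) ∂μ := setLIntegral_mono' hs hpointwise
    _ = a * μ s + ∫⁻ y in s, ∑' i, (t i).indicator (g i) y ∂μ := by
        rw [lintegral_add_left measurable_const, setLIntegral_const]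
    _ ≤ a * μ s + ∫⁻ y, ∑' i, (t i).indicator (g i) y ∂μ := by
        gcongr
        exact Measure.restrict_le_self
    _ = a * μ s + ∑' i, ∫⁻ y in t i, g i y ∂μ := by
        rw [lintegral_tsum fun i => (aemeasurable_indicator_iff (ht i)).2 (hg i)]
        simp only [lintegral_indicator (ht _)]

end LIntegral

/-- Choosing, among the members of `t` containing a given point, one whose radius is more than
half of their supremum is what upgrades the Vitali covering to a bound on all their radii. -/
theorem exists_pairwiseDisjoint_balls_covering_maximal {X : Type*} [PseudoMetricSpace X]
    {t : Set (X × ℝ)} {R : ℝ} (ht : ∀ b ∈ t, b.2 ∈ Ioc 0 R) :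
    ∃ u ⊆ t, u.PairwiseDisjoint (fun b => ball b.1 b.2) ∧
      ∀ x, (∃ a ∈ t, x ∈ ball a.1 a.2) →
        ∃ b ∈ u, x ∈ ball b.1 (5 * b.2) ∧ ∀ a ∈ t, x ∈ ball a.1 a.2 → a.2 ≤ 4 * b.2 := by
  obtain ⟨u, hut, hdisj, hcov⟩ := Vitali.exists_disjoint_subfamily_covering_enlargement
    (fun b : X × ℝ => ball b.1 b.2) t Prod.snd 2 one_lt_two (fun b hb => (ht b hb).1.le)
    R (fun b hb => (ht b hb).2) (fun b hb => ⟨b.1, mem_ball_self (ht b hb).1⟩)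
  refine ⟨u, hut, hdisj, fun x ⟨a₀, ha₀, hxa₀⟩ => ?_⟩
  set radii : Set ℝ := Prod.snd '' {a ∈ t | x ∈ ball a.1 a.2}
  have hbdd : BddAbove radii := ⟨R, forall_mem_image.2 fun a ha => (ht a ha.1).2⟩
  have hmem : ∀ a ∈ t, x ∈ ball a.1 a.2 → a.2 ∈ radii := fun a ha hxa => ⟨a, ⟨ha, hxa⟩, rfl⟩
  have hpos : 0 < sSup radii := (ht a₀ ha₀).1.trans_le (le_csSup hbdd (hmem a₀ ha₀ hxa₀))
  obtain ⟨_, ⟨a₁, ⟨ha₁, hxa₁⟩, rfl⟩, hhalf⟩ :=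
    exists_lt_of_lt_csSup ⟨_, hmem a₀ ha₀ hxa₀⟩ (half_lt_self hpos)
  obtain ⟨b, hb, ⟨z, hza₁, hzb⟩, hle⟩ := hcov a₁ ha₁
  rw [mem_ball] at hxa₁ hza₁ hzb
  refine ⟨b, hb, mem_ball.2 ?_, fun a ha hxa => ?_⟩
  · linarith [dist_triangle x a₁.1 b.1, dist_triangle_left a₁.1 b.1 z]
  · linarith [le_csSup hbdd (hmem a ha hxa)]

variable {X : Type*} [MetricSpace X] [MeasurableSpace X] {μ : Measure X} {Cd D : ℝ} {f : X → ℝ}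

section Doubling

theorem IsDoubling.measure_ball_ne_zero (hμ : IsDoubling μ Cd) (x : X) {r : ℝ} (hr : 0 < r) :
    μ (ball x r) ≠ 0 := by
  have h := (hμ x (r / 2) (half_pos hr)).1
  rw [mul_div_cancel₀ r two_ne_zero] at h
  exact h.ne'

theorem IsDoubling.measure_ball_ne_top (hμ : IsDoubling μ Cd) (x : X) {r : ℝ} (hr : 0 < r) :
    μ (ball x r) ≠ ∞ :=
  (hμ x r hr).2.2.ne

theorem IsDoubling.measureReal_ball_pos (hμ : IsDoubling μ Cd) (x : X) {r : ℝ} (hr : 0 < r) :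
    0 < μ.real (ball x r) :=
  ENNReal.toReal_pos (hμ.measure_ball_ne_zero x hr) (hμ.measure_ball_ne_top x hr)

theorem IsDoubling.one_le (hμ : IsDoubling μ Cd) (x : X) : 1 ≤ Cd := by
  have hle : 1 * μ (ball x 1) ≤ ENNReal.ofReal Cd * μ (ball x 1) := by
    rw [one_mul]
    exact (measure_mono (ball_subset_ball (by norm_num))).trans (hμ x 1 one_pos).2.1
  exact ENNReal.one_le_ofReal.1 <| (ENNReal.mul_le_mul_iff_left
    (hμ.measure_ball_ne_zero x one_pos) (hμ.measure_ball_ne_top x one_pos)).1 hle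

theorem IsDoubling.measure_ball_two_pow_mul_le (hμ : IsDoubling μ Cd) (k : ℕ) (x : X) {r : ℝ}
    (hr : 0 < r) : μ (ball x (2 ^ k * r)) ≤ ENNReal.ofReal (Cd ^ k) * μ (ball x r) := by
  have hCd := hμ.one_le x
  induction k with
  | zero => simp
  | succ k ih =>
    rw [pow_succ', mul_assoc, pow_succ', ENNReal.ofReal_mul (zero_le_one.trans hCd), mul_assoc]
    exact (hμ x (2 ^ k * r) (by positivity)).2.1.trans (by gcongr)

theorem IsDoubling.measure_ball_le (hμ : IsDoubling μ Cd) (k : ℕ) {x y : X} {r s : ℝ}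
    (hr : 0 < r) (h : s + dist y x ≤ 2 ^ k * r) :
    μ (ball y s) ≤ ENNReal.ofReal (Cd ^ k) * μ (ball x r) :=
  (measure_mono (ball_subset_ball' h)).trans (hμ.measure_ball_two_pow_mul_le k x hr)

theorem IsDoubling.measureReal_ball_le (hμ : IsDoubling μ Cd) (k : ℕ) {x y : X} {r s : ℝ}
    (hr : 0 < r) (h : s + dist y x ≤ 2 ^ k * r) :
    μ.real (ball y s) ≤ Cd ^ k * μ.real (ball x r) := by
  have hCd := hμ.one_le x
  have hle := ENNReal.toReal_mono
    (ENNReal.mul_ne_top ENNReal.ofReal_ne_top (hμ.measure_ball_ne_top x hr))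
    (hμ.measure_ball_le k hr h)
  rwa [ENNReal.toReal_mul, ENNReal.toReal_ofReal (by positivity)] at hle

theorem IsDoubling.finite_of_pairwiseDisjoint_ball [OpensMeasurableSpace X]
    (hμ : IsDoubling μ Cd) {c : X} {R δ : ℝ} (hR : 0 < R) (hδ : 0 < δ) {u : Set X}
    (hu : u ⊆ ball c R) (hdisj : u.PairwiseDisjoint (fun x => ball x δ)) : u.Finite := by
  obtain ⟨k, hk⟩ := pow_unbounded_of_one_lt (2 * R / δ) (one_lt_two : (1 : ℝ) < 2)
  rw [div_lt_iff₀ hδ] at hk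
  have hlower : ∀ x : u, μ (ball c R) / ENNReal.ofReal (Cd ^ k) ≤ μ (ball (x : X) δ) :=
    fun x => ENNReal.div_le_of_le_mul' <| hμ.measure_ball_le k hδ <| by
      linarith [mem_ball'.1 (hu x.2)]
  have hfinite : μ (⋃ x : u, ball (x : X) δ) ≠ ∞ := by
    refine measure_ne_top_of_subset (iUnion_subset fun x => ball_subset_ball' ?_)
      (hμ.measure_ball_ne_top c (r := δ + R) (by positivity))
    linarith [mem_ball.1 (hu x.2)]
  have hfin := Measure.finite_const_le_meas_of_disjoint_iUnion μ
    (ENNReal.div_pos (hμ.measure_ball_ne_zero c hR) (ENNReal.ofReal_ne_top (r := Cd ^ k)))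
    (fun _ : u => measurableSet_ball) ((pairwise_subtype_iff_pairwise_set _ _).2 hdisj) hfinite
  exact finite_coe_iff.1 (finite_univ_iff.1 (hfin.subset fun x _ => hlower x))

theorem IsDoubling.totallyBounded_ball [OpensMeasurableSpace X] (hμ : IsDoubling μ Cd) (c : X)
    (R : ℝ) : TotallyBounded (ball c R) := by
  rcases le_or_gt R 0 with hR | hR
  · simp only [ball_eq_empty.2 hR, totallyBounded_empty]
  refine Metric.totallyBounded_iff.2 fun ε hε => ?_
  have hδ : 0 < ε / 5 := by positivity
  obtain ⟨u, hu, hdisj, hcov⟩ := Vitali.exists_disjoint_subfamily_covering_enlargement_ball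
    (ball c R) id (fun _ => ε / 5) (ε / 5) (fun _ _ => le_rfl) 5 (by norm_num)
  refine ⟨u, hμ.finite_of_pairwiseDisjoint_ball hR hδ hu hdisj, fun x hx => ?_⟩
  obtain ⟨b, hb, hsub⟩ := hcov x hx
  rw [mul_div_cancel₀ ε (by norm_num)] at hsub
  exact mem_biUnion hb (hsub (mem_ball_self hδ))

theorem IsDoubling.integrableOn_ball [OpensMeasurableSpace X] [CompleteSpace X]
    (hμ : IsDoubling μ Cd) (hf : LocallyIntegrable f μ) (c : X) (r : ℝ) :
    IntegrableOn f (ball c r) μ := by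
  have hcompact : IsCompact (closure (ball c r)) :=
    (hμ.totallyBounded_ball c r).closure.isCompact_of_isClosed isClosed_closure
  exact (hf.integrableOn_isCompact hcompact).mono_set subset_closure

theorem IsDoubling.countable_of_pairwiseDisjoint_ball [OpensMeasurableSpace X]
    (hμ : IsDoubling μ Cd) {u : Set (X × ℝ)} {c : X} {R : ℝ} (hR : 0 < R)
    (hpos : ∀ b ∈ u, 0 < b.2) (hsub : ∀ b ∈ u, ball b.1 b.2 ⊆ ball c R)
    (hdisj : u.PairwiseDisjoint (fun b => ball b.1 b.2)) : u.Countable := by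
  have hcount := Measure.countable_meas_pos_of_disjoint_of_meas_iUnion_ne_top μ
    (As := fun b : u => ball b.1.1 b.1.2) (fun _ => measurableSet_ball)
    ((pairwise_subtype_iff_pairwise_set _ _).2 hdisj)
    (measure_ne_top_of_subset (iUnion_subset fun b => hsub b b.2)
      (hμ.measure_ball_ne_top c hR))
  have hall : {b : u | 0 < μ (ball b.1.1 b.1.2)} = univ := eq_univ_of_forall fun b =>
    pos_iff_ne_zero.2 (hμ.measure_ball_ne_zero _ (hpos b b.2))
  rwa [hall, countable_univ_iff] at hcount

theorem IsDoubling.setLIntegral_add_const_le (hμ : IsDoubling μ Cd) (k : ℕ) {y : X} {s t : ℝ}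
    {g : X → ℝ≥0∞} {A K : ℝ≥0∞} (hs : 0 < s) (hts : t ≤ 2 ^ k * s)
    (hg : ∫⁻ x in ball y t, g x ∂μ ≤ A * μ (ball y t)) :
    ∫⁻ x in ball y t, (g x + K) ∂μ ≤ (A + K) * ENNReal.ofReal (Cd ^ k) * μ (ball y s) :=
  calc ∫⁻ x in ball y t, (g x + K) ∂μ
      = ∫⁻ x in ball y t, g x ∂μ + K * μ (ball y t) := by
        rw [lintegral_add_right _ measurable_const, setLIntegral_const]
    _ ≤ (A + K) * μ (ball y t) := by
        rw [add_mul]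
        gcongr
    _ ≤ (A + K) * (ENNReal.ofReal (Cd ^ k) * μ (ball y s)) := by
        gcongr
        exact hμ.measure_ball_le k hs (by linarith [dist_self y])
    _ = (A + K) * ENNReal.ofReal (Cd ^ k) * μ (ball y s) := (mul_assoc _ _ _).symm

end Doubling

/-- The average `f_B` of `f` over the ball `B = B(c, r)`. -/
noncomputable abbrev ballAverage (μ : Measure X) (f : X → ℝ) (c : X) (r : ℝ) : ℝ :=
  ⨍ y in ball c r, f y ∂μ

/-- The mean oscillation of `f` over every ball is at most `D`. This is `‖f‖_BMO ≤ D`, with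
integrability on balls in place of local integrability so that no compactness is needed. -/
structure MeanOscillationLE (μ : Measure X) (f : X → ℝ) (D : ℝ) : Prop where
  integrableOn : ∀ (c : X) (r : ℝ), IntegrableOn f (ball c r) μ
  setAverage_le : ∀ (c : X) (r : ℝ), 0 < r → ⨍ y in ball c r, |f y - ballAverage μ f c r| ∂μ ≤ D

section MeanOscillation

theorem MeanOscillationLE.nonneg (hf : MeanOscillationLE μ f D) (x : X) : 0 ≤ D :=
  (integral_nonneg fun _ => abs_nonneg _).trans (hf.setAverage_le x 1 one_pos)

theorem MeanOscillationLE.mono {D' : ℝ} (hf : MeanOscillationLE μ f D) (hD : D ≤ D') :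
    MeanOscillationLE μ f D' :=
  ⟨hf.integrableOn, fun c r hr => (hf.setAverage_le c r hr).trans hD⟩

theorem MeanOscillationLE.integrableOn_sub_ballAverage (hf : MeanOscillationLE μ f D)
    (hμ : IsDoubling μ Cd) (c : X) {r : ℝ} (hr : 0 < r) :
    IntegrableOn (fun y => f y - ballAverage μ f c r) (ball c r) μ :=
  (hf.integrableOn c r).sub (integrableOn_const (hμ.measure_ball_ne_top c hr))

theorem MeanOscillationLE.lintegral_enorm_sub_le (hf : MeanOscillationLE μ f D)
    (hμ : IsDoubling μ Cd) (c : X) {r : ℝ} (hr : 0 < r) :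
    ∫⁻ y in ball c r, ‖f y - ballAverage μ f c r‖ₑ ∂μ ≤ ENNReal.ofReal D * μ (ball c r) := by
  have hμr := hμ.measure_ball_ne_top c hr
  have hosc : 0 ≤ ⨍ y in ball c r, |f y - ballAverage μ f c r| ∂μ :=
    integral_nonneg fun _ => abs_nonneg _
  calc ∫⁻ y in ball c r, ‖f y - ballAverage μ f c r‖ₑ ∂μ
      = ENNReal.ofReal (∫ y in ball c r, |f y - ballAverage μ f c r| ∂μ) :=
        (ofReal_integral_norm_eq_lintegral_enorm
          (hf.integrableOn_sub_ballAverage hμ c hr)).symm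
    _ = ENNReal.ofReal (⨍ y in ball c r, |f y - ballAverage μ f c r| ∂μ) * μ (ball c r) := by
        rw [← measure_smul_setAverage _ hμr, smul_eq_mul, mul_comm,
          ENNReal.ofReal_mul hosc, ofReal_measureReal hμr]
    _ ≤ ENNReal.ofReal D * μ (ball c r) := by
        gcongr
        exact hf.setAverage_le c r hr

theorem MeanOscillationLE.abs_sub_le_of_subset (hf : MeanOscillationLE μ f D)
    (hμ : IsDoubling μ Cd) (k : ℕ) {x y : X} {r s : ℝ} (hr : 0 < r)
    (hsub : ball x r ⊆ ball y s) (h : s + dist y x ≤ 2 ^ k * r) :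
    |ballAverage μ f x r - ballAverage μ f y s| ≤ Cd ^ k * D := by
  have hs : 0 < s := dist_nonneg.trans_lt (mem_ball.1 (hsub (mem_ball_self hr)))
  have hCd := hμ.one_le x
  calc |ballAverage μ f x r - ballAverage μ f y s|
      ≤ ⨍ z in ball x r, |f z - ballAverage μ f y s| ∂μ :=
        norm_setAverage_sub_le (hμ.measure_ball_ne_zero x hr) (hμ.measure_ball_ne_top x hr)
          (hf.integrableOn x r) _
    _ ≤ Cd ^ k * ⨍ z in ball y s, |f z - ballAverage μ f y s| ∂μ :=
        setAverage_le_mul_setAverage_of_subset (fun _ => abs_nonneg _)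
          (hf.integrableOn_sub_ballAverage hμ y hs).abs hsub (hμ.measureReal_ball_pos x hr)
          (hμ.measure_ball_ne_top y hs) (hμ.measureReal_ball_le k hr h)
    _ ≤ Cd ^ k * D := by
        gcongr
        exact hf.setAverage_le y s hs

theorem MeanOscillationLE.abs_sub_le (hf : MeanOscillationLE μ f D) (hμ : IsDoubling μ Cd)
    (k : ℕ) {x y : X} {r s : ℝ} (hr : 0 < r) (hs : 0 < s) (hxr : r + s + 2 * dist x y ≤ 2 ^ k * r)
    (hys : r + s + 2 * dist x y ≤ 2 ^ k * s) :
    |ballAverage μ f x r - ballAverage μ f y s| ≤ 2 * Cd ^ k * D := by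
  have hxy : 0 ≤ dist x y := dist_nonneg
  set R := r + s + dist x y
  calc |ballAverage μ f x r - ballAverage μ f y s|
      ≤ |ballAverage μ f x r - ballAverage μ f x R|
          + |ballAverage μ f y s - ballAverage μ f x R| := by
        rw [abs_sub_comm (ballAverage μ f y s)]
        exact _root_.abs_sub_le _ _ _
    _ ≤ Cd ^ k * D + Cd ^ k * D := by
        refine add_le_add
          (hf.abs_sub_le_of_subset hμ k hr (ball_subset_ball (by linarith)) ?_)
          (hf.abs_sub_le_of_subset hμ k hs (ball_subset_ball' ?_) ?_)
        · linarith [dist_self x]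
        · linarith [dist_comm x y]
        · linarith
    _ = 2 * Cd ^ k * D := by ring

theorem MeanOscillationLE.abs (hf : MeanOscillationLE μ f D) (hμ : IsDoubling μ Cd) :
    MeanOscillationLE μ (fun x => |f x|) (2 * D) := by
  refine ⟨fun c r => (hf.integrableOn c r).abs, fun c r hr => ?_⟩
  have hμ₀ := hμ.measure_ball_ne_zero c hr
  have hμr := hμ.measure_ball_ne_top c hr
  have habs := (hf.integrableOn c r).abs
  calc ⨍ y in ball c r, |(|f y| - ballAverage μ (fun x => |f x|) c r)| ∂μ
      ≤ 2 * ⨍ y in ball c r, |(|f y| - |ballAverage μ f c r|)| ∂μ :=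
        setAverage_norm_sub_setAverage_le hμ₀ hμr habs _
    _ ≤ 2 * ⨍ y in ball c r, |f y - ballAverage μ f c r| ∂μ := by
        gcongr ?_ * ?_
        exact integral_mono (habs.sub (integrableOn_const hμr)).abs.to_average
          (hf.integrableOn_sub_ballAverage hμ c hr).abs.to_average
          fun y => abs_abs_sub_abs_le (f y) _
    _ ≤ 2 * D := by
        gcongr
        exact hf.setAverage_le c r hr

end MeanOscillation

/-- The largest amount by which the averages of `f` over balls `B(c', s) ∋ x` with
`ε < s ≤ r / 10` fall below the average over `B(c, 2r)`, or `0` if none does. The strict lower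
bound on `s` lets `ε = 0` account for all small scales at once. -/
noncomputable def averageDrop (μ : Measure X) (f : X → ℝ) (c : X) (r ε : ℝ) (x : X) : ℝ≥0∞ :=
  ⨆ (c' : X) (s ∈ Ioc ε (r / 10)) (_ : x ∈ ball c' s),
    ENNReal.ofReal (ballAverage μ f c (2 * r) - ballAverage μ f c' s)

/-- The balls `b = B(b.1, b.2)` meeting `B(c, r)`, with radius in `(ε, r / 10]`, over which the
average of `f` falls by more than `l` below its average over `B(c, 2r)`. -/
def dropBalls (μ : Measure X) (f : X → ℝ) (c : X) (r ε l : ℝ) : Set (X × ℝ) :=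
  {b | b.2 ∈ Ioc ε (r / 10) ∧ (ball b.1 b.2 ∩ ball c r).Nonempty ∧
    l < ballAverage μ f c (2 * r) - ballAverage μ f b.1 b.2}

section AverageDrop

variable {c x y : X} {r s ε l : ℝ}

theorem le_averageDrop {c' : X} (hs : s ∈ Ioc ε (r / 10)) (hx : x ∈ ball c' s) :
    ENNReal.ofReal (ballAverage μ f c (2 * r) - ballAverage μ f c' s)
      ≤ averageDrop μ f c r ε x :=
  le_iSup_of_le c' <| le_iSup₂_of_le s hs <| le_iSup_of_le hx le_rfl

theorem averageDrop_le_iff {a : ℝ≥0∞} :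
    averageDrop μ f c r ε x ≤ a ↔ ∀ c', ∀ s ∈ Ioc ε (r / 10), x ∈ ball c' s →
      ENNReal.ofReal (ballAverage μ f c (2 * r) - ballAverage μ f c' s) ≤ a := by
  simp only [averageDrop, iSup_le_iff]

theorem averageDrop_eq_zero_of_le (h : r / 10 ≤ ε) : averageDrop μ f c r ε x = 0 :=
  nonpos_iff_eq_zero.1 <| averageDrop_le_iff.2 fun _ _ hs => absurd (hs.1.trans_le hs.2) h.not_gt

theorem averageDrop_anti : Antitone fun ε => averageDrop μ f c r ε x := fun _ _ hε =>
  averageDrop_le_iff.2 fun _ _ hs hx => le_averageDrop ⟨hε.trans_lt hs.1, hs.2⟩ hx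

theorem iSup_averageDrop :
    ⨆ n : ℕ, averageDrop μ f c r (1 / (n + 1)) x = averageDrop μ f c r 0 x := by
  refine le_antisymm (iSup_le fun n => averageDrop_anti (by positivity))
    (averageDrop_le_iff.2 fun c' s hs hx => ?_)
  obtain ⟨n, hn⟩ := exists_nat_one_div_lt hs.1
  exact le_iSup_of_le n (le_averageDrop ⟨hn, hs.2⟩ hx)

theorem lowerSemicontinuous_averageDrop : LowerSemicontinuous (averageDrop μ f c r ε) := by
  intro x a ha
  simp only [averageDrop, lt_iSup_iff, exists_prop] at ha
  obtain ⟨c', s, hs, hx, hlt⟩ := ha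
  filter_upwards [isOpen_ball.mem_nhds hx] with y hy using hlt.trans_le (le_averageDrop hs hy)

theorem measurable_averageDrop [OpensMeasurableSpace X] : Measurable (averageDrop μ f c r ε) :=
  lowerSemicontinuous_averageDrop.measurable

theorem ball_subset_of_mem_dropBalls {b : X × ℝ} (hb : b ∈ dropBalls μ f c r ε l) :
    ball b.1 b.2 ⊆ ball c (2 * r) := by
  obtain ⟨⟨-, hbr⟩, ⟨z, hzb, hzc⟩, -⟩ := hb
  rw [mem_ball] at hzb hzc
  have hr : 0 < r := dist_nonneg.trans_lt hzc
  exact ball_subset_ball' (by linarith [dist_triangle_left b.1 c z])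

theorem MeanOscillationLE.mul_tsum_measure_le [OpensMeasurableSpace X]
    (hf : MeanOscillationLE μ f D) (hμ : IsDoubling μ Cd) (hr : 0 < r) (hε : 0 ≤ ε)
    {u : Set (X × ℝ)} [Countable u] (hu : u ⊆ dropBalls μ f c r ε l)
    (hdisj : u.PairwiseDisjoint fun b => ball b.1 b.2) :
    ENNReal.ofReal l * ∑' b : u, μ (ball b.1.1 b.1.2)
      ≤ ENNReal.ofReal (D * Cd) * μ (ball c r) := by
  set m := ballAverage μ f c (2 * r)
  have hoscillation : ∀ b : u, ENNReal.ofReal l * μ (ball b.1.1 b.1.2)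
      ≤ ∫⁻ y in ball b.1.1 b.1.2, ‖f y - m‖ₑ ∂μ := by
    rintro ⟨b, hb⟩
    obtain ⟨⟨hεb, -⟩, -, hdrop⟩ := hu hb
    have hμb := hμ.measure_ball_ne_top b.1 (hε.trans_lt hεb)
    rw [← measure_mul_setLAverage _ hμb, mul_comm]
    gcongr
    calc ENNReal.ofReal l ≤ ENNReal.ofReal (m - ballAverage μ f b.1 b.2) := by gcongr
      _ ≤ ‖m - ballAverage μ f b.1 b.2‖ₑ := Real.ofReal_le_enorm _
      _ = ‖ballAverage μ f b.1 b.2 - m‖ₑ := enorm_sub_rev _ _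
      _ ≤ ⨍⁻ y in ball b.1 b.2, ‖f y - m‖ₑ ∂μ :=
        enorm_setAverage_sub_le (hμ.measure_ball_ne_zero b.1 (hε.trans_lt hεb)) hμb
          (hf.integrableOn _ _) m
  calc ENNReal.ofReal l * ∑' b : u, μ (ball b.1.1 b.1.2)
      ≤ ∫⁻ y in ball c (2 * r), ‖f y - m‖ₑ ∂μ :=
        mul_tsum_measure_le_lintegral (fun _ => measurableSet_ball)
          ((pairwise_subtype_iff_pairwise_set _ _).2 hdisj)
          (fun b => ball_subset_of_mem_dropBalls (hu b.2)) hoscillation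
    _ ≤ ENNReal.ofReal D * μ (ball c (2 * r)) := hf.lintegral_enorm_sub_le hμ c (by positivity)
    _ ≤ ENNReal.ofReal D * (ENNReal.ofReal Cd * μ (ball c r)) := by
        gcongr
        exact (hμ c r hr).2.1
    _ = ENNReal.ofReal (D * Cd) * μ (ball c r) := by
        rw [ENNReal.ofReal_mul (hf.nonneg c), mul_assoc]

/-- The ball `B(x, 5s)` either is too large to count for the drop or, being larger than every drop
ball through `x`, is not itself a drop ball; in both cases it is comparable to `B(y, 10s)`. -/
theorem MeanOscillationLE.ballAverage_sub_le_of_forall_le (hf : MeanOscillationLE μ f D)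
    (hμ : IsDoubling μ Cd) (hε : 0 ≤ ε) (hl : 0 ≤ l) (hx : x ∈ ball c r)
    (hys : (y, s) ∈ dropBalls μ f c r ε l) (hxy : x ∈ ball y (5 * s))
    (hmax : ∀ a ∈ dropBalls μ f c r ε l, x ∈ ball a.1 a.2 → a.2 ≤ 4 * s) :
    ballAverage μ f c (2 * r) - ballAverage μ f y (2 * (5 * s)) ≤ l + 2 * Cd ^ 6 * D := by
  obtain ⟨⟨hεs, hsr⟩, ⟨z, hzy, hzc⟩, -⟩ := hys
  simp only [mem_ball] at hεs hsr hzy hzc hxy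
  have hs : 0 < s := hε.trans_lt hεs
  rcases le_or_gt (5 * s) (r / 10) with hsmall | hlarge
  · have hdrop : ballAverage μ f c (2 * r) - ballAverage μ f x (5 * s) ≤ l := by
      by_contra! hlt
      have hmem : x ∈ ball x (5 * s) := mem_ball_self (by positivity)
      have := hmax (x, 5 * s) ⟨⟨by linarith, hsmall⟩, ⟨x, hmem, hx⟩, hlt⟩ hmem
      dsimp only at this
      linarith
    have hcomp := hf.abs_sub_le hμ 6 (x := x) (y := y) (r := 5 * s) (s := 2 * (5 * s))
      (by positivity) (by positivity) (by linarith) (by linarith)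
    linarith [le_abs_self (ballAverage μ f x (5 * s) - ballAverage μ f y (2 * (5 * s)))]
  · have hcomp := hf.abs_sub_le hμ 6 (x := c) (y := y) (r := 2 * r) (s := 2 * (5 * s))
      (by linarith) (by positivity) (by linarith [dist_triangle_left c y z])
      (by linarith [dist_triangle_left c y z])
    linarith [le_abs_self (ballAverage μ f c (2 * r) - ballAverage μ f y (2 * (5 * s)))]

theorem MeanOscillationLE.averageDrop_le_add (hf : MeanOscillationLE μ f D)
    (hμ : IsDoubling μ Cd) (hε : 0 ≤ ε) (hl : 0 ≤ l) (hx : x ∈ ball c r)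
    (hys : (y, s) ∈ dropBalls μ f c r ε l) (hxy : x ∈ ball y (5 * s))
    (hmax : ∀ a ∈ dropBalls μ f c r ε l, x ∈ ball a.1 a.2 → a.2 ≤ 4 * s) :
    averageDrop μ f c r ε x
      ≤ averageDrop μ f y (5 * s) ε x + ENNReal.ofReal (l + 4 * Cd ^ 6 * D) := by
  have hcompare := hf.ballAverage_sub_le_of_forall_le hμ hε hl hx hys hxy hmax
  have hs : 0 < s := hε.trans_lt hys.1.1
  have hCd := hμ.one_le x
  have hD := hf.nonneg x
  have hCdD : 0 ≤ Cd ^ 6 * D := by positivity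
  refine averageDrop_le_iff.2 fun c' t ht hxt => ?_
  rcases le_or_gt (ballAverage μ f c (2 * r) - ballAverage μ f c' t) l with hdrop | hdrop
  · exact le_add_left (ENNReal.ofReal_le_ofReal (by linarith))
  have hts : t ≤ 4 * s := hmax (c', t) ⟨ht, ⟨x, hxt, hx⟩, hdrop⟩ hxt
  rcases le_or_gt t (5 * s / 10) with hsmall | hlarge
  · calc ENNReal.ofReal (ballAverage μ f c (2 * r) - ballAverage μ f c' t)
        ≤ ENNReal.ofReal ((ballAverage μ f y (2 * (5 * s)) - ballAverage μ f c' t)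
            + (l + 4 * Cd ^ 6 * D)) := ENNReal.ofReal_le_ofReal (by linarith)
      _ ≤ ENNReal.ofReal (ballAverage μ f y (2 * (5 * s)) - ballAverage μ f c' t)
            + ENNReal.ofReal (l + 4 * Cd ^ 6 * D) := ENNReal.ofReal_add_le
      _ ≤ averageDrop μ f y (5 * s) ε x + ENNReal.ofReal (l + 4 * Cd ^ 6 * D) := by
        gcongr
        exact le_averageDrop ⟨ht.1, hsmall⟩ hxt
  · rw [mem_ball] at hxt hxy
    have hcomp := hf.abs_sub_le hμ 6 (x := y) (y := c') (r := 2 * (5 * s)) (s := t)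
      (by positivity) (hε.trans_lt ht.1) (by linarith [dist_triangle_left y c' x])
      (by linarith [dist_triangle_left y c' x])
    refine le_add_left (ENNReal.ofReal_le_ofReal ?_)
    linarith [le_abs_self (ballAverage μ f y (2 * (5 * s)) - ballAverage μ f c' t)]

theorem MeanOscillationLE.exists_lintegral_averageDrop_le [OpensMeasurableSpace X]
    (hf : MeanOscillationLE μ f D) (hμ : IsDoubling μ Cd) (hr : 0 < r) (hε : 0 ≤ ε) (hl : 0 ≤ l) :
    ∃ u ⊆ dropBalls μ f c r ε l, u.Countable ∧ u.PairwiseDisjoint (fun b => ball b.1 b.2) ∧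
      ∫⁻ x in ball c r, averageDrop μ f c r ε x ∂μ ≤ ENNReal.ofReal l * μ (ball c r) +
        ∑' b : u, ∫⁻ x in ball b.1.1 (5 * b.1.2),
          (averageDrop μ f b.1.1 (5 * b.1.2) ε x + ENNReal.ofReal (l + 4 * Cd ^ 6 * D)) ∂μ := by
  obtain ⟨u, hu, hdisj, hcover⟩ :=
    exists_pairwiseDisjoint_balls_covering_maximal (t := dropBalls μ f c r ε l) (R := r / 10)
      fun b hb => ⟨hε.trans_lt hb.1.1, hb.1.2⟩
  have hcount : u.Countable := hμ.countable_of_pairwiseDisjoint_ball (mul_pos two_pos hr)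
    (fun b hb => hε.trans_lt (hu hb).1.1) (fun b hb => ball_subset_of_mem_dropBalls (hu hb)) hdisj
  have := hcount.to_subtype
  refine ⟨u, hu, hcount, hdisj, setLIntegral_le_of_forall_le_or_exists_le measurableSet_ball
    (fun _ => measurableSet_ball) (fun _ => (measurable_averageDrop.add_const _).aemeasurable)
    fun x hx => or_iff_not_imp_left.2 fun hlarge => ?_⟩
  simp only [averageDrop_le_iff, not_forall, not_le] at hlarge
  obtain ⟨c', s, hs, hxs, hdrop⟩ := hlarge
  obtain ⟨b, hb, hxb, hmax⟩ := hcover x ⟨(c', s), ⟨hs, ⟨x, hxs, hx⟩,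
    (ENNReal.ofReal_lt_ofReal_iff_of_nonneg hl).1 hdrop⟩, hxs⟩
  exact ⟨⟨b, hb⟩, hxb, hf.averageDrop_le_add hμ hε hl hx (hu hb) hxb hmax⟩

theorem MeanOscillationLE.lintegral_averageDrop_le_of_forall_le [OpensMeasurableSpace X]
    (hf : MeanOscillationLE μ f D) (hμ : IsDoubling μ Cd) (hr : 0 < r) (hε : 0 ≤ ε) (hl : 0 < l)
    {A : ℝ} (hA₀ : 0 ≤ A)
    (hA : ∀ y s, 0 < s → s ≤ r / 2 →
      ∫⁻ x in ball y s, averageDrop μ f y s ε x ∂μ ≤ ENNReal.ofReal A * μ (ball y s)) :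
    ∫⁻ x in ball c r, averageDrop μ f c r ε x ∂μ
      ≤ ENNReal.ofReal (l + (A + (l + 4 * Cd ^ 6 * D)) * Cd ^ 3 / l * (D * Cd)) *
        μ (ball c r) := by
  have hCd := hμ.one_le c
  have hD := hf.nonneg c
  obtain ⟨u, hu, hcount, hdisj, hle⟩ :=
    hf.exists_lintegral_averageDrop_le hμ (c := c) hr hε hl.le
  have := hcount.to_subtype
  have hK₀ : 0 ≤ l + 4 * Cd ^ 6 * D := by positivity
  generalize l + 4 * Cd ^ 6 * D = K at hle hK₀ ⊢
  have hq₀ : 0 ≤ (A + K) * Cd ^ 3 / l := by positivity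
  calc ∫⁻ x in ball c r, averageDrop μ f c r ε x ∂μ
      ≤ ENNReal.ofReal l * μ (ball c r) + ∑' b : u, ∫⁻ x in ball b.1.1 (5 * b.1.2),
          (averageDrop μ f b.1.1 (5 * b.1.2) ε x + ENNReal.ofReal K) ∂μ := hle
    _ ≤ ENNReal.ofReal l * μ (ball c r) +
          ∑' b : u, ENNReal.ofReal ((A + K) * Cd ^ 3) * μ (ball b.1.1 b.1.2) := by
        gcongr _ + ∑' b, ?_ with b
        obtain ⟨hεb, hbr⟩ := (hu b.2).1
        have hb₀ : 0 < b.1.2 := hε.trans_lt hεb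
        rw [ENNReal.ofReal_mul (add_nonneg hA₀ hK₀), ENNReal.ofReal_add hA₀ hK₀]
        exact hμ.setLIntegral_add_const_le 3 hb₀ (by linarith)
          (hA _ _ (by positivity) (by linarith))
    _ = ENNReal.ofReal l * μ (ball c r) + ENNReal.ofReal ((A + K) * Cd ^ 3 / l) *
          (ENNReal.ofReal l * ∑' b : u, μ (ball b.1.1 b.1.2)) := by
        rw [ENNReal.tsum_mul_left, ← mul_assoc (ENNReal.ofReal _), ← ENNReal.ofReal_mul hq₀,
          div_mul_cancel₀ _ hl.ne']
    _ ≤ ENNReal.ofReal l * μ (ball c r) + ENNReal.ofReal ((A + K) * Cd ^ 3 / l) *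
          (ENNReal.ofReal (D * Cd) * μ (ball c r)) := by
        gcongr _ + _ * ?_
        exact hf.mul_tsum_measure_le hμ hr hε hu hdisj
    _ = ENNReal.ofReal (l + (A + K) * Cd ^ 3 / l * (D * Cd)) * μ (ball c r) := by
        rw [ENNReal.ofReal_add hl.le (by positivity), ENNReal.ofReal_mul hq₀,
          add_mul (ENNReal.ofReal l), mul_assoc]

theorem MeanOscillationLE.lintegral_averageDrop_le_half_add [OpensMeasurableSpace X]
    (hf : MeanOscillationLE μ f D) (hμ : IsDoubling μ Cd) (hD : 0 < D) (hr : 0 < r) (hε : 0 ≤ ε)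
    {A : ℝ} (hA₀ : 0 ≤ A)
    (hA : ∀ y s, 0 < s → s ≤ r / 2 →
      ∫⁻ x in ball y s, averageDrop μ f y s ε x ∂μ ≤ ENNReal.ofReal A * μ (ball y s)) :
    ∫⁻ x in ball c r, averageDrop μ f c r ε x ∂μ
      ≤ ENNReal.ofReal (A / 2 + 5 * Cd ^ 6 * D) * μ (ball c r) := by
  have hCd := hμ.one_le c
  refine (hf.lintegral_averageDrop_le_of_forall_le hμ hr hε (l := 2 * Cd ^ 4 * D) (by positivity)
    hA₀ hA).trans ?_
  gcongr ENNReal.ofReal ?_ * _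
  have hpow : Cd ^ 4 * D ≤ Cd ^ 6 * D := by
    gcongr
    norm_num
  calc 2 * Cd ^ 4 * D + (A + (2 * Cd ^ 4 * D + 4 * Cd ^ 6 * D)) * Cd ^ 3 / (2 * Cd ^ 4 * D) *
          (D * Cd)
      = 2 * Cd ^ 4 * D + (A + (2 * Cd ^ 4 * D + 4 * Cd ^ 6 * D)) / 2 := by field_simp
    _ ≤ A / 2 + 5 * Cd ^ 6 * D := by linarith

theorem MeanOscillationLE.lintegral_averageDrop_le_of_pos [OpensMeasurableSpace X]
    (hf : MeanOscillationLE μ f D) (hμ : IsDoubling μ Cd) (hD : 0 < D) (hε : 0 < ε) (c : X)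
    (hr : 0 < r) :
    ∫⁻ x in ball c r, averageDrop μ f c r ε x ∂μ
      ≤ ENNReal.ofReal (10 * Cd ^ 6 * D) * μ (ball c r) := by
  have hCd := hμ.one_le c
  obtain ⟨n, hn⟩ := pow_unbounded_of_one_lt (r / ε) (one_lt_two : (1 : ℝ) < 2)
  rw [div_lt_iff₀ hε] at hn
  induction n generalizing c r with
  | zero =>
    rw [pow_zero, one_mul] at hn
    simp only [averageDrop_eq_zero_of_le (show r / 10 ≤ ε by linarith), lintegral_zero, zero_le]
  | succ n ih =>
    rw [pow_succ] at hn
    have hhalf := hf.lintegral_averageDrop_le_half_add hμ hD hr hε.le (c := c)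
      (A := 10 * Cd ^ 6 * D) (by positivity) fun y s hs hsr => ih y hs (by linarith)
    rwa [show 10 * Cd ^ 6 * D / 2 + 5 * Cd ^ 6 * D = 10 * Cd ^ 6 * D by ring] at hhalf

theorem MeanOscillationLE.lintegral_averageDrop_le [OpensMeasurableSpace X]
    (hf : MeanOscillationLE μ f D) (hμ : IsDoubling μ Cd) (c : X) (hr : 0 < r) :
    ∫⁻ x in ball c r, averageDrop μ f c r 0 x ∂μ
      ≤ ENNReal.ofReal (10 * Cd ^ 6 * D) * μ (ball c r) := by
  simp only [← iSup_averageDrop]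
  rw [lintegral_iSup (fun _ => measurable_averageDrop)
    fun _ _ hmn _ => averageDrop_anti (one_div_le_one_div_of_le (by positivity) (by gcongr))]
  refine iSup_le fun n => ?_
  have hlim : Tendsto (fun D' => ENNReal.ofReal (10 * Cd ^ 6 * D') * μ (ball c r)) (𝓝[>] D)
      (𝓝 (ENNReal.ofReal (10 * Cd ^ 6 * D) * μ (ball c r))) :=
    ENNReal.Tendsto.mul_const
      (ENNReal.tendsto_ofReal (Tendsto.const_mul _ (tendsto_nhdsWithin_of_tendsto_nhds tendsto_id)))
      (Or.inr (hμ.measure_ball_ne_top c hr))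
  refine ge_of_tendsto hlim (eventually_mem_nhdsWithin.mono fun D' hD' => ?_)
  exact (hf.mono (le_of_lt hD')).lintegral_averageDrop_le_of_pos hμ
    ((hf.nonneg c).trans_lt hD') (by positivity) c hr

theorem MeanOscillationLE.lintegral_averageDrop_ne_top [OpensMeasurableSpace X]
    (hf : MeanOscillationLE μ f D) (hμ : IsDoubling μ Cd) (c : X) (hr : 0 < r) :
    ∫⁻ x in ball c r, averageDrop μ f c r 0 x ∂μ ≠ ∞ :=
  ne_top_of_le_ne_top (ENNReal.mul_ne_top ENNReal.ofReal_ne_top (hμ.measure_ball_ne_top c hr))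
    (hf.lintegral_averageDrop_le hμ c hr)

theorem MeanOscillationLE.integrableOn_toReal_averageDrop [OpensMeasurableSpace X]
    (hf : MeanOscillationLE μ f D) (hμ : IsDoubling μ Cd) (c : X) (hr : 0 < r) :
    IntegrableOn (fun x => (averageDrop μ f c r 0 x).toReal) (ball c r) μ :=
  integrable_toReal_of_lintegral_ne_top measurable_averageDrop.aemeasurable
    (hf.lintegral_averageDrop_ne_top hμ c hr)

theorem MeanOscillationLE.ae_averageDrop_lt_top [OpensMeasurableSpace X]
    (hf : MeanOscillationLE μ f D) (hμ : IsDoubling μ Cd) (c : X) (hr : 0 < r) :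
    ∀ᵐ x ∂μ.restrict (ball c r), averageDrop μ f c r 0 x < ∞ :=
  ae_lt_top measurable_averageDrop (hf.lintegral_averageDrop_ne_top hμ c hr)

theorem MeanOscillationLE.setAverage_toReal_averageDrop_le [OpensMeasurableSpace X]
    (hf : MeanOscillationLE μ f D) (hμ : IsDoubling μ Cd) (c : X) (hr : 0 < r) :
    ⨍ x in ball c r, (averageDrop μ f c r 0 x).toReal ∂μ ≤ 10 * Cd ^ 6 * D := by
  have hD := hf.nonneg c
  rw [setAverage_eq, smul_eq_mul, inv_mul_le_iff₀ (hμ.measureReal_ball_pos c hr),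
    integral_toReal measurable_averageDrop.aemeasurable (hf.ae_averageDrop_lt_top hμ c hr),
    mul_comm, measureReal_def, ← ENNReal.toReal_ofReal (by positivity : 0 ≤ 10 * Cd ^ 6 * D),
    ← ENNReal.toReal_mul]
  exact ENNReal.toReal_mono
    (ENNReal.mul_ne_top ENNReal.ofReal_ne_top (hμ.measure_ball_ne_top c hr))
    (hf.lintegral_averageDrop_le hμ c hr)

end AverageDrop

section NaturalMinimal

variable {c x y : X} {r v : ℝ}

theorem naturalMinimal_le (hr : 0 < r) (hx : x ∈ ball c r) :
    naturalMinimal μ f x ≤ ballAverage μ f c r :=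
  iInf_le_of_le c <| iInf_le_of_le r <| iInf₂_le_of_le hr hx le_rfl

theorem naturalMinimal_ne_top : naturalMinimal μ f x ≠ ⊤ :=
  ne_top_of_le_ne_top (EReal.coe_ne_top _) (naturalMinimal_le one_pos (mem_ball_self one_pos))

theorem coe_toReal_naturalMinimal (hx : naturalMinimal μ f x ≠ ⊥) :
    ((naturalMinimal μ f x).toReal : EReal) = naturalMinimal μ f x :=
  EReal.coe_toReal naturalMinimal_ne_top hx

theorem upperSemicontinuous_naturalMinimal : UpperSemicontinuous (naturalMinimal μ f) := by
  intro x a ha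
  simp only [naturalMinimal, iInf_lt_iff, exists_prop] at ha
  obtain ⟨c, r, hr, hx, hlt⟩ := ha
  filter_upwards [isOpen_ball.mem_nhds hx] with y hy using (naturalMinimal_le hr hy).trans_lt hlt

theorem measurable_naturalMinimal [OpensMeasurableSpace X] : Measurable (naturalMinimal μ f) :=
  upperSemicontinuous_naturalMinimal.measurable

theorem MeanOscillationLE.sub_le_ballAverage (hf : MeanOscillationLE μ f D)
    (hμ : IsDoubling μ Cd) (hx : x ∈ ball c r) (hy : y ∈ ball c r)
    (hv : (v : EReal) ≤ naturalMinimal μ f y) (hdrop : averageDrop μ f c r 0 x ≠ ∞)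
    {c' : X} {s : ℝ} (hs : 0 < s) (hxs : x ∈ ball c' s) :
    v - Cd ^ 5 * D - (averageDrop μ f c r 0 x).toReal ≤ ballAverage μ f c' s := by
  have hCd := hμ.one_le x
  have hD := hf.nonneg x
  have hr : 0 < r := dist_nonneg.trans_lt (mem_ball.1 hx)
  have hle : ∀ {z t}, 0 < t → y ∈ ball z t → v ≤ ballAverage μ f z t := fun ht hyt =>
    EReal.coe_le_coe_iff.1 (hv.trans (naturalMinimal_le ht hyt))
  rcases le_or_gt s (r / 10) with hsmall | hlarge
  · have hvc := hle (by positivity) (ball_subset_ball (by linarith : r ≤ 2 * r) hy)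
    have hdrop_le := (ENNReal.ofReal_le_iff_le_toReal hdrop).1
      (le_averageDrop (μ := μ) (f := f) (c := c) ⟨hs, hsmall⟩ hxs)
    linarith [show 0 ≤ Cd ^ 5 * D by positivity]
  · have hyc' : y ∈ ball c' (32 * s) := by
      rw [mem_ball] at hx hy hxs ⊢
      linarith [dist_triangle y x c', dist_triangle_right y x c]
    have hvc' := hle (by positivity) hyc'
    have hcomp := hf.abs_sub_le_of_subset hμ 5 hs (ball_subset_ball (by linarith : s ≤ 32 * s))
      (by linarith [dist_self c'])
    linarith [neg_abs_le (ballAverage μ f c' s - ballAverage μ f c' (32 * s)),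
      (averageDrop μ f c r 0 x).toReal_nonneg]

theorem MeanOscillationLE.sub_le_naturalMinimal (hf : MeanOscillationLE μ f D)
    (hμ : IsDoubling μ Cd) (hx : x ∈ ball c r) (hy : y ∈ ball c r)
    (hv : (v : EReal) ≤ naturalMinimal μ f y) (hdrop : averageDrop μ f c r 0 x ≠ ∞) :
    ((v - Cd ^ 5 * D - (averageDrop μ f c r 0 x).toReal : ℝ) : EReal) ≤ naturalMinimal μ f x :=
  le_iInf₂ fun _ _ => le_iInf₂ fun hs hxs =>
    EReal.coe_le_coe_iff.2 (hf.sub_le_ballAverage hμ hx hy hv hdrop hs hxs)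

variable [OpensMeasurableSpace X]

theorem MeanOscillationLE.ae_ne_bot_and_le_toReal_naturalMinimal (hf : MeanOscillationLE μ f D)
    (hμ : IsDoubling μ Cd) (hy : y ∈ ball c r) (hv : (v : EReal) ≤ naturalMinimal μ f y) :
    ∀ᵐ x ∂μ.restrict (ball c r), naturalMinimal μ f x ≠ ⊥ ∧
      v - Cd ^ 5 * D - (averageDrop μ f c r 0 x).toReal ≤ (naturalMinimal μ f x).toReal := by
  have hr : 0 < r := dist_nonneg.trans_lt (mem_ball.1 hy)
  filter_upwards [hf.ae_averageDrop_lt_top hμ c hr, ae_restrict_mem measurableSet_ball]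
    with x hdrop hx
  have hle := hf.sub_le_naturalMinimal hμ hx hy hv hdrop.ne
  have hbot : naturalMinimal μ f x ≠ ⊥ := ne_bot_of_le_ne_bot (EReal.coe_ne_bot _) hle
  exact ⟨hbot, EReal.coe_le_coe_iff.1 (hle.trans_eq (coe_toReal_naturalMinimal hbot).symm)⟩

theorem MeanOscillationLE.integrableOn_toReal_naturalMinimal (hf : MeanOscillationLE μ f D)
    (hμ : IsDoubling μ Cd) (hy : y ∈ ball c r) (hv : (v : EReal) ≤ naturalMinimal μ f y) :
    IntegrableOn (fun x => (naturalMinimal μ f x).toReal) (ball c r) μ := by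
  have hr : 0 < r := dist_nonneg.trans_lt (mem_ball.1 hy)
  have hconst : ∀ a : ℝ, IntegrableOn (fun _ => a) (ball c r) μ := fun _ =>
    integrableOn_const (hμ.measure_ball_ne_top c hr)
  have hlower := hf.ae_ne_bot_and_le_toReal_naturalMinimal hμ hy hv
  have hupper : ∀ᵐ x ∂μ.restrict (ball c r),
      (naturalMinimal μ f x).toReal ≤ ballAverage μ f c r := by
    filter_upwards [hlower, ae_restrict_mem measurableSet_ball] with x ⟨hbot, _⟩ hx
    exact EReal.coe_le_coe_iff.1
      ((coe_toReal_naturalMinimal hbot).trans_le (naturalMinimal_le hr hx))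
  exact integrable_of_le_of_le measurable_naturalMinimal.ereal_toReal.aestronglyMeasurable
    (hlower.mono fun x hx => hx.2) hupper
    ((hconst (v - Cd ^ 5 * D)).sub (hf.integrableOn_toReal_averageDrop hμ c hr)) (hconst _)

theorem MeanOscillationLE.sub_le_setAverage_toReal_naturalMinimal (hf : MeanOscillationLE μ f D)
    (hμ : IsDoubling μ Cd) (hy : y ∈ ball c r) (hv : (v : EReal) ≤ naturalMinimal μ f y) :
    v - 11 * Cd ^ 6 * D ≤ ⨍ x in ball c r, (naturalMinimal μ f x).toReal ∂μ := by
  have hr : 0 < r := dist_nonneg.trans_lt (mem_ball.1 hy)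
  have hCd := hμ.one_le c
  have hD := hf.nonneg c
  have hμr := hμ.measure_ball_ne_top c hr
  have hdrop := hf.integrableOn_toReal_averageDrop hμ c hr
  have hconst : IntegrableOn (fun _ => v - Cd ^ 5 * D) (ball c r) μ := integrableOn_const hμr
  have hpow : Cd ^ 5 * D ≤ Cd ^ 6 * D := by
    gcongr
    norm_num
  calc v - 11 * Cd ^ 6 * D
      ≤ (v - Cd ^ 5 * D) - ⨍ x in ball c r, (averageDrop μ f c r 0 x).toReal ∂μ := by
        linarith [hf.setAverage_toReal_averageDrop_le hμ c hr]
    _ = (⨍ _ in ball c r, (v - Cd ^ 5 * D) ∂μ)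
          - ⨍ x in ball c r, (averageDrop μ f c r 0 x).toReal ∂μ := by
        rw [setAverage_const (hμ.measure_ball_ne_zero c hr) hμr]
    _ = ⨍ x in ball c r, (v - Cd ^ 5 * D - (averageDrop μ f c r 0 x).toReal) ∂μ :=
        (integral_sub hconst.to_average hdrop.to_average).symm
    _ ≤ ⨍ x in ball c r, (naturalMinimal μ f x).toReal ∂μ :=
        integral_mono_ae (hconst.sub hdrop).to_average
          (hf.integrableOn_toReal_naturalMinimal hμ hy hv).to_average
          (Measure.ae_smul_measure
            ((hf.ae_ne_bot_and_le_toReal_naturalMinimal hμ hy hv).mono fun _ hx => hx.2) _)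

theorem MeanOscillationLE.buoNorm_naturalMinimal_le (hf : MeanOscillationLE μ f D)
    (hμ : IsDoubling μ Cd) :
    buoNorm μ (naturalMinimal μ f) ≤ ((11 * Cd ^ 6 * D : ℝ) : EReal) := by
  refine iSup_le fun c => iSup₂_le fun r _ => EReal.sub_le_of_le_add (essSup_le_of_ae_le _ ?_)
  filter_upwards [ae_restrict_mem measurableSet_ball] with y hy
  rcases eq_or_ne (naturalMinimal μ f y) ⊥ with hbot | hbot
  · simp only [hbot, bot_le]
  · rw [← coe_toReal_naturalMinimal hbot, ← EReal.coe_add, EReal.coe_le_coe_iff]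
    linarith [hf.sub_le_setAverage_toReal_naturalMinimal hμ hy
      (coe_toReal_naturalMinimal hbot).le]

theorem MeanOscillationLE.memBUO_naturalMinimal (hf : MeanOscillationLE μ f D)
    (hμ : IsDoubling μ Cd) (hx : naturalMinimal μ f x ≠ ⊥) :
    MemBUO μ (naturalMinimal μ f) := by
  have hv := (coe_toReal_naturalMinimal hx).le
  refine ⟨?_, fun y => ?_, (hf.buoNorm_naturalMinimal_le hμ).trans_lt (EReal.coe_lt_top _)⟩
  · suffices hcover : ∀ᵐ z ∂μ.restrict (⋃ n : ℕ, ball x (n + 1)),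
        naturalMinimal μ f z ≠ ⊥ ∧ naturalMinimal μ f z ≠ ⊤ by
      rwa [iUnion_ball_nat_succ, Measure.restrict_univ] at hcover
    refine (ae_restrict_iUnion_iff _ _).2 fun n => ?_
    filter_upwards [hf.ae_ne_bot_and_le_toReal_naturalMinimal hμ
      (mem_ball_self (by positivity : (0 : ℝ) < n + 1)) hv] with z hz
    exact ⟨hz.1, naturalMinimal_ne_top⟩
  · have hy : y ∈ ball x (dist y x + 1) := mem_ball.2 (lt_add_one _)
    exact ⟨ball x (dist y x + 1), isOpen_ball.mem_nhds hy,
      hf.integrableOn_toReal_naturalMinimal hμ (mem_ball_self (by positivity)) hv⟩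

end NaturalMinimal

section Norms

theorem naturalMinimal_ne_bot_of_nonneg (hf : 0 ≤ f) (x : X) : naturalMinimal μ f x ≠ ⊥ :=
  ne_bot_of_le_ne_bot EReal.zero_ne_bot <| le_iInf₂ fun _ _ => le_iInf₂ fun _ _ =>
    EReal.coe_nonneg.2 (integral_nonneg hf)

theorem minimal_eq_naturalMinimal_abs : minimal μ f = naturalMinimal μ fun x => |f x| := rfl

theorem bmoNorm_nonneg (x : X) : 0 ≤ bmoNorm μ f :=
  le_iSup_of_le x <| le_iSup₂_of_le 1 one_pos <|
    EReal.coe_nonneg.2 (integral_nonneg fun _ => abs_nonneg _)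

theorem meanOscillationLE_of_bmoNorm_le (hint : ∀ c r, IntegrableOn f (ball c r) μ)
    (hf : bmoNorm μ f ≤ (D : EReal)) : MeanOscillationLE μ f D :=
  ⟨hint, fun c r hr => EReal.coe_le_coe_iff.1 (iSup₂_le_iff.1 (iSup_le_iff.1 hf c) r hr)⟩

theorem buoNorm_of_isEmpty [IsEmpty X] (g : X → EReal) : buoNorm μ g = ⊥ :=
  iSup_of_empty _

theorem memBUO_of_isEmpty [IsEmpty X] (g : X → EReal) : MemBUO μ g :=
  ⟨Eventually.of_forall isEmptyElim, isEmptyElim, buoNorm_of_isEmpty (μ := μ) g ▸ bot_lt_top⟩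

end Norms

end MetricOscillation

open MetricOscillation in
theorem mainTheorem10_general {X : Type*} [MetricSpace X] [MeasurableSpace X]
    [OpensMeasurableSpace X] {μ : Measure X} {Cd : ℝ} (hμ : IsDoubling μ Cd) {f : X → ℝ}
    (hint : ∀ c r, IntegrableOn f (ball c r) μ) (hf : bmoNorm μ f < ⊤) :
    ((∃ x, naturalMinimal μ f x ≠ ⊥) → MemBUO μ (naturalMinimal μ f) ∧
      buoNorm μ (naturalMinimal μ f) ≤ ((22 * Cd ^ 6 : ℝ) : EReal) * bmoNorm μ f) ∧
    (MemBUO μ (minimal μ f) ∧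
      buoNorm μ (minimal μ f) ≤ ((22 * Cd ^ 6 : ℝ) : EReal) * bmoNorm μ f) := by
  rcases isEmpty_or_nonempty X with hX | ⟨⟨x₀⟩⟩
  · exact ⟨fun ⟨x, _⟩ => isEmptyElim x, memBUO_of_isEmpty _, buoNorm_of_isEmpty (μ := μ) _ ▸ bot_le⟩
  have hnonneg : 0 ≤ bmoNorm μ f := bmoNorm_nonneg x₀
  lift bmoNorm μ f to ℝ using ⟨hf.ne, ne_bot_of_le_ne_bot EReal.zero_ne_bot hnonneg⟩ with D hD
  have hosc : MeanOscillationLE μ f D := meanOscillationLE_of_bmoNorm_le hint hD.ge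
  have hosc_two : MeanOscillationLE μ f (2 * D) := hosc.mono (by linarith [hosc.nonneg x₀])
  have habs : MeanOscillationLE μ (fun x => |f x|) (2 * D) := hosc.abs hμ
  rw [minimal_eq_naturalMinimal_abs, ← EReal.coe_mul,
    show 22 * Cd ^ 6 * D = 11 * Cd ^ 6 * (2 * D) by ring]
  exact ⟨fun ⟨x, hx⟩ =>
      ⟨hosc.memBUO_naturalMinimal hμ hx, hosc_two.buoNorm_naturalMinimal_le hμ⟩,
    habs.memBUO_naturalMinimal hμ (naturalMinimal_ne_bot_of_nonneg (fun _ => abs_nonneg _) x₀),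
    habs.buoNorm_naturalMinimal_le hμ⟩

theorem mainTheorem10 (Cd : ℝ) (hCd : 1 < Cd) :
    ∃ C : ℝ, 0 < C ∧
      ∀ (X : Type u) [MetricSpace X] [CompleteSpace X] [MeasurableSpace X] [BorelSpace X]
        (μ : Measure X),
        MetricOscillation.IsDoubling μ Cd →
        MetricOscillation.HasAnnularDecay μ →
        ∀ f : X → ℝ, MetricOscillation.MemBMO μ f →
          ((∃ x : X, MetricOscillation.naturalMinimal μ f x ≠ ⊥) →
            MetricOscillation.MemBUO μ (MetricOscillation.naturalMinimal μ f) ∧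
            MetricOscillation.buoNorm μ (MetricOscillation.naturalMinimal μ f)
              ≤ (C : EReal) * MetricOscillation.bmoNorm μ f) ∧
          (MetricOscillation.MemBUO μ (MetricOscillation.minimal μ f) ∧
            MetricOscillation.buoNorm μ (MetricOscillation.minimal μ f)
              ≤ (C : EReal) * MetricOscillation.bmoNorm μ f) :=
  ⟨22 * Cd ^ 6, by positivity, fun _ _ _ _ _ _ hμ _ _ hf =>
    mainTheorem10_general hμ (hμ.integrableOn_ball hf.1) hf.2⟩
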